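/- Let $G$ be a finite group and let $S=(\mathcal X,\mathcal Y)$ be a supercharacter theory of $G$: $\mathcal X$ is a partition of the set $\mathrm{Irr}(G)$ of irreducible complex characters of $G$, $\mathcal Y$ is a partition of $G$ with $\{1\}\in\mathcal Y$, $|\mathcal X|=|\mathcal Y|$, and for each $X\in\mathcal X$ the character $\sigma_X=\sum_{\chi\in X}\chi(1)\chi$ is constant on each member of $\mathcal Y$. Put $\mathrm{Irr}(S)=\{\sigma_X : X\in\mathcal X\}$ and, for $g\in G$, let $\mathrm{Cl}_S(g)$ be the member of $\mathcal Y$ containing $g$. A subgroup of $G$ is called $S$-normal if it is a union of members of $\mathcal Y$. Define $$Z(S)=\{g\in G : |\mathrm{Cl}_S(g)|=1\},\qquad [G,S]=\langle\, g^{-1}k : g\in G,\ k\in \mathrm{Cl}_S(g)\,\rangle .$$ For a subgroup $N\le G$, let $\mathrm{Irr}(S\mid N)$ be the set of $\chi\in\mathrm{Irr}(S)$ with $N\not\subseteq\ker\chi=\{g\in G:\chi(g)=\chi(1)\}$, and let $$V(S\mid N)=\langle\, g\in G : \chi(g)\ne 0 \text{ for some } \chi\in\mathrm{Irr}(S\mid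 N)\,\rangle,\qquad V(S)=V(S\mid [G,S]).$$ Let $U(S)=U(S\mid Z(S))$ be the product of all $S$-normal subgroups $H$ of $G$ such that $V(S\mid H)\subseteq Z(S)$. Suppose that $G$ is not $S$-abelian, that is, $Z(S)\ne G$. Then the following are equivalent: 1. $G$ is a $VZ(S)$-group, i.e. every $\chi\in\mathrm{Irr}(S\mid[G,S])$ vanishes on $G\setminus Z(S)$; 2. $Z(S)=V(S)$; 3. $U(S)=[G,S]$. -/

import Mathlib

noncomputable section

/-- `Irr(G)`: the set of characters of irreducible complex representations of `G` of finite
dimension. Up to isomorphism the space of such a representation is `ℂⁿ`. -/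
def IrrChar (G : Type*) [Group G] : Set (G → ℂ) :=
  {χ | ∃ (n : ℕ) (ρ : Representation ℂ G (Fin n → ℂ)), ρ.IsIrreducible ∧ χ = ρ.character}

/-- A finite group has finitely many irreducible characters, so that the sums and the
cardinalities below are those of finite sets. -/
instance IrrChar.instFinite (G : Type*) [Group G] [Finite G] : Finite (IrrChar G) := by
  classical
  haveI : Fintype G := Fintype.ofFinite G
  have hc : (Nat.card G : ℂ) ≠ 0 := by exact_mod_cast Nat.card_pos.ne'
  haveI : Invertible (Nat.card G : ℂ) := invertibleOfNonzero hc
  have horth : ∀ χ ψ : IrrChar G,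
      (Nat.card G : ℂ)⁻¹ * ∑ g : G, χ.1 g * ψ.1 g⁻¹ = if χ = ψ then 1 else 0 := by
    rintro ⟨_, n, ρ, hρ, rfl⟩ ⟨_, m, τ, hτ, rfl⟩
    haveI := hρ
    haveI := hτ
    split_ifs with h
    · have h' : ρ.character = τ.character := congrArg Subtype.val h
      simp only
      rw [← h', Representation.char_orthonormal, if_pos ⟨Representation.Equiv.refl ρ⟩]
    · simp only
      rw [Representation.char_orthonormal, if_neg]
      rintro ⟨e⟩
      exact h (Subtype.ext (Representation.char_iso e).symm)
  have hli : LinearIndependent ℂ (fun χ : IrrChar G => (χ.1 : G → ℂ)) := by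
    rw [linearIndependent_iff']
    intro s a ha ψ hψ
    have h1 : (Nat.card G : ℂ)⁻¹ * ∑ g : G, (∑ χ ∈ s, a χ • (χ.1 : G → ℂ)) g * ψ.1 g⁻¹ = a ψ := by
      have : ∀ g : G, (∑ χ ∈ s, a χ • (χ.1 : G → ℂ)) g * ψ.1 g⁻¹
          = ∑ χ ∈ s, a χ * (χ.1 g * ψ.1 g⁻¹) := by
        intro g
        simp [Finset.sum_apply, Finset.sum_mul, mul_assoc]
      simp only [this]
      rw [Finset.sum_comm, Finset.mul_sum]
      have h2 : ∀ χ ∈ s, (Nat.card G : ℂ)⁻¹ * ∑ g : G, a χ * (χ.1 g * ψ.1 g⁻¹)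
          = if χ = ψ then a χ else 0 := by
        intro χ _
        rw [← Finset.mul_sum, mul_left_comm, horth]
        simp
      rw [Finset.sum_congr rfl h2]
      simp [hψ]
    rw [ha] at h1
    simpa using h1.symm
  exact hli.finite

/-- The character `σ_X = ∑_{χ ∈ X} χ(1) χ` attached to a set `X` of irreducible characters. -/
def sigmaChar {G : Type*} [Group G] (X : Set (IrrChar G)) : G → ℂ :=
  fun g => ∑ᶠ χ ∈ X, (χ : G → ℂ) 1 * (χ : G → ℂ) g

/-- A supercharacter theory of `G` (Diaconis and Isaacs): a partition of `Irr(G)` and a partition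
of `G` into superclasses. -/
structure SupercharacterTheory (G : Type*) [Group G] where
  /-- the parts of `Irr(G)` -/
  parts : Set (Set (IrrChar G))
  /-- the superclasses -/
  classes : Set (Set G)
  isPartition_parts : Setoid.IsPartition parts
  isPartition_classes : Setoid.IsPartition classes
  singleton_one_mem : {1} ∈ classes
  card_eq : parts.ncard = classes.ncard
  sigma_const : ∀ X ∈ parts, ∀ K ∈ classes, ∀ g ∈ K, ∀ h ∈ K, sigmaChar X g = sigmaChar X h

/-- The kernel `{g | χ(g) = χ(1)}` of a character. -/
def charKer {G : Type*} [Group G] (χ : G → ℂ) : Set G := {g | χ g = χ 1}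

namespace SupercharacterTheory

variable {G : Type*} [Group G] (S : SupercharacterTheory G)

/-- `Cl_S(g)`: the superclass that contains `g`. -/
def cl (g : G) : Set G := {k | ∃ K ∈ S.classes, g ∈ K ∧ k ∈ K}

/-- `Irr(S)`: the set of supercharacters. -/
def irr : Set (G → ℂ) := {σ | ∃ X ∈ S.parts, σ = sigmaChar X}

/-- A subgroup is `S`-normal if it is a union of superclasses. -/
def IsNormal (N : Subgroup G) : Prop := ∃ C ⊆ S.classes, (N : Set G) = ⋃₀ C

/-- `Irr(S | N)`: the supercharacters whose kernel does not contain `N`. -/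
def irrOver (N : Subgroup G) : Set (G → ℂ) := {χ ∈ S.irr | ¬ (N : Set G) ⊆ charKer χ}

/-- `Z(S)`: the set of elements whose superclass has one element. -/
def center : Set G := {g | (S.cl g).ncard = 1}

/-- `G` is `S`-abelian if `Z(S) = G`. -/
def IsAbelian : Prop := S.center = Set.univ

/-- `[H, S]`: the subgroup generated by the `g⁻¹ k` with `g ∈ H` and `k ∈ Cl_S(g)`. -/
def commutator (H : Subgroup G) : Subgroup G :=
  Subgroup.closure {x | ∃ g ∈ H, ∃ k ∈ S.cl g, x = g⁻¹ * k}

/-- `V(S | N)`: the subgroup generated by the elements at which some member of `Irr(S | N)` does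
not vanish. -/
def vanishingOff (N : Subgroup G) : Subgroup G :=
  Subgroup.closure {g | ∃ χ ∈ S.irrOver N, χ g ≠ 0}

/-- `V(S) = V(S | [G, S])`. -/
def V : Subgroup G := S.vanishingOff (S.commutator ⊤)

/-- `U(S | N)`: the product of all `S`-normal subgroups `H` with `V(S | H) ⊆ N`. The product of a
family of normal subgroups is the subgroup that they generate, their supremum. The definition
makes sense for every subset `N`, so it applies to the set `Z(S)` directly. -/
def UOver (N : Set G) : Subgroup G :=
  sSup {H | S.IsNormal H ∧ (S.vanishingOff H : Set G) ⊆ N}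

/-- `U(S) = U(S | Z(S))`. -/
def U : Subgroup G := S.UOver S.center

/-- `G` is a `VZ(S)`-group if every member of `Irr(S | [G, S])` vanishes on `G ∖ Z(S)`. -/
def IsVZ : Prop := ∀ χ ∈ S.irrOver (S.commutator ⊤), ∀ g : G, g ∉ S.center → χ g = 0

end SupercharacterTheory

end

/-!
# Supercharacter theories with `VZ(S)`

Orthogonality of irreducible characters makes the supercharacters `σ_X` linearly independent.
As there are as many of them as superclasses, they span the space of functions constant on
superclasses (`span_irr`). Hence for such a function `f` the quotient `⟨f, χ⟩ / χ(1)` is the same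
for all `χ` in one part `X` (`coeff_mul_apply_one`). The argument uses this in three ways.

* If `z ∈ Z(S)`, the indicator of `z` is a superclass function and `z` is central in `G`. By Schur's
  lemma `z` acts on each irreducible representation as a scalar, and the scalar depends on the part
  only. Thus translation by `z` multiplies `σ_X` by a nonzero number. Therefore `Z(S)` is a subgroup
  and no supercharacter vanishes at a point of `Z(S)`.
* A linear character of `G / [G, S]` is a superclass function, and so it is a supercharacter by
  itself (`monoidHom_mem_irr`); it vanishes nowhere. If `V(S | H) ⊆ Z(S) ≠ G`, then no such
  character is nontrivial on `H`, and `H ≤ [G, S]`.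
* The supercharacters separate `1` from the other elements, so `Irr(S | N)` is nonempty if `N ≠ 1`.

As `Z(S)` is a subgroup, `VZ(S)` says that `V(S) ⊆ Z(S)`, and `Z(S) ⊆ V(S)` holds whenever
`[G, S] ≠ 1`. If `V(S) ⊆ Z(S)`, then `[G, S]`, which is `S`-normal, is the largest subgroup in the
family that defines `U(S)`. Conversely `V(S | U(S)) ⊆ Z(S)` always holds
(`vanishingOff_U_subset_center`), since a supercharacter whose kernel contains every member of the
family has the whole of `U(S)` in its kernel: a subgroup on which `σ_X` is constant acts trivially
on every representation with character in `X`.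
-/

/-! ### Irreducible characters -/

namespace IrrChar

variable {G : Type*} [Group G]

/-- The degree of an irreducible character is a positive natural number. -/
theorem exists_apply_one_eq (χ : IrrChar G) : ∃ n : ℕ, 0 < n ∧ (χ : G → ℂ) 1 = n := by
  obtain ⟨_, n, ρ, hρ, rfl⟩ := χ
  refine ⟨n, Nat.pos_of_ne_zero ?_, by simp⟩
  rintro rfl
  exact bot_ne_top (α := Subrepresentation ρ)
    (Subrepresentation.toSubmodule_injective (Subsingleton.elim _ _))

theorem apply_one_ne_zero (χ : IrrChar G) : (χ : G → ℂ) 1 ≠ 0 := by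
  obtain ⟨n, hn, h⟩ := exists_apply_one_eq χ
  rw [h]
  exact_mod_cast hn.ne'

theorem apply_conj (χ : IrrChar G) (g x : G) :
    (χ : G → ℂ) (x * g * x⁻¹) = (χ : G → ℂ) g := by
  obtain ⟨_, n, ρ, hρ, rfl⟩ := χ
  exact ρ.char_conj g x

/-- Schur's lemma for characters: a central element acts on an irreducible representation
as a scalar. -/
theorem apply_mul_of_central (χ : IrrChar G) {z : G} (hz : ∀ x, z * x = x * z) :
    ∃ c : ℂ, c ≠ 0 ∧ ∀ x, (χ : G → ℂ) (z * x) = c * (χ : G → ℂ) x := by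
  have hχ := apply_one_ne_zero χ
  obtain ⟨_, n, ρ, hρ, rfl⟩ := χ
  let f : Representation.IntertwiningMap ρ ρ :=
    (ρ z).intertwiningMap_of_isIntertwiningMap ρ ρ fun g v ↦ by
      rw [← Module.End.mul_apply, ← Module.End.mul_apply, ← map_mul, ← map_mul, hz]
  obtain ⟨c, hc⟩ :=
    (Representation.IsIrreducible.algebraMap_intertwiningMap_bijective_of_isAlgClosed
      (ρ := ρ)).2 f
  have hzc : ρ z = c • LinearMap.id := by
    have := congrArg (fun F : Representation.IntertwiningMap ρ ρ ↦ F.toLinearMap) hc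
    exact this.symm
  have key : ∀ x, ρ.character (z * x) = c * ρ.character x := by
    intro x
    have : ρ (z * x) = c • ρ x := by
      rw [map_mul, hzc]
      ext v
      simp
    simp [Representation.character, this]
  refine ⟨c, ?_, key⟩
  rintro rfl
  apply hχ
  have := key z⁻¹
  rwa [mul_inv_cancel, zero_mul] at this

/-- A homomorphism to `ℂˣ` is an irreducible character. -/
theorem monoidHom_mem (φ : G →* ℂˣ) : (fun g ↦ (φ g : ℂ)) ∈ IrrChar G := by
  let ρ : Representation ℂ G (Fin 1 → ℂ) :=
    { toFun := fun g ↦ (φ g : ℂ) • LinearMap.id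
      map_one' := by ext; simp
      map_mul' := fun g h ↦ by
        rw [map_mul, Units.val_mul, mul_smul, smul_mul_assoc, mul_smul_comm]
        rfl }
  have hsimple : IsSimpleOrder (Submodule ℂ (Fin 1 → ℂ)) :=
    (isSimpleModule_iff ℂ _).1 (isSimpleModule_iff_finrank_eq_one.2 (by simp))
  refine ⟨1, ρ, ?_, ?_⟩
  · refine { exists_pair_ne := ⟨⊥, ⊤, fun h ↦ ?_⟩, eq_bot_or_eq_top := fun W ↦ ?_ }
    · exact bot_ne_top (α := Submodule ℂ (Fin 1 → ℂ))
        (congrArg Subrepresentation.toSubmodule h)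
    · exact (hsimple.eq_bot_or_eq_top W.toSubmodule).imp
        (fun h ↦ Subrepresentation.toSubmodule_injective h)
        (fun h ↦ Subrepresentation.toSubmodule_injective h)
  · ext g
    change _ = LinearMap.trace ℂ (Fin 1 → ℂ) ((φ g : ℂ) • LinearMap.id)
    simp

variable [Fintype G]

theorem orthonormal [DecidableEq (IrrChar G)] (χ ψ : IrrChar G) :
    (Nat.card G : ℂ)⁻¹ * ∑ g : G, (χ : G → ℂ) g * (ψ : G → ℂ) g⁻¹ = if χ = ψ then 1 else 0 := by
  have hc : (Nat.card G : ℂ) ≠ 0 := by exact_mod_cast Nat.card_pos.ne'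
  have : Invertible (Nat.card G : ℂ) := invertibleOfNonzero hc
  obtain ⟨_, n, ρ, hρ, rfl⟩ := χ
  obtain ⟨_, m, τ, hτ, rfl⟩ := ψ
  split_ifs with h
  · have h' : ρ.character = τ.character := congrArg Subtype.val h
    simp only
    rw [← h', Representation.char_orthonormal, if_pos ⟨Representation.Equiv.refl ρ⟩]
  · simp only
    rw [Representation.char_orthonormal, if_neg]
    rintro ⟨e⟩
    exact h (Subtype.ext (Representation.char_iso e).symm)

/-- The coefficient `⟨f, χ⟩` of a function `f` at the irreducible character `χ`. The value
`χ(g⁻¹)` takes the place of the complex conjugate of `χ(g)`. -/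
noncomputable def coeff (χ : IrrChar G) : (G → ℂ) →ₗ[ℂ] ℂ where
  toFun f := (Nat.card G : ℂ)⁻¹ * ∑ g : G, f g * (χ : G → ℂ) g⁻¹
  map_add' f₁ f₂ := by simp [add_mul, Finset.sum_add_distrib, mul_add]
  map_smul' a f := by
    simp only [Pi.smul_apply, smul_eq_mul, RingHom.id_apply, mul_assoc, ← Finset.mul_sum]
    ring

theorem coeff_apply (χ : IrrChar G) (f : G → ℂ) :
    coeff χ f = (Nat.card G : ℂ)⁻¹ * ∑ g : G, f g * (χ : G → ℂ) g⁻¹ := rfl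

end IrrChar

/-! ### The characters `σ_X` -/

section sigmaChar

variable {G : Type*} [Group G]

open scoped Classical in
theorem sigmaChar_eq_sum [Finite G] [Fintype (IrrChar G)] (X : Set (IrrChar G)) :
    sigmaChar X = ∑ χ : IrrChar G with χ ∈ X, (χ : G → ℂ) 1 • (χ : G → ℂ) := by
  ext g
  rw [sigmaChar, finsum_mem_eq_sum_of_inter_support_eq (t := {χ : IrrChar G | χ ∈ X})]
  · simp
  · simp

open scoped Classical in
theorem coeff_sigmaChar [Fintype G] (X : Set (IrrChar G)) (χ : IrrChar G) :
    IrrChar.coeff χ (sigmaChar X) = if χ ∈ X then (χ : G → ℂ) 1 else 0 := by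
  have := Fintype.ofFinite (IrrChar G)
  rw [sigmaChar_eq_sum, map_sum]
  simp only [map_smul, IrrChar.coeff_apply, IrrChar.orthonormal, smul_eq_mul, mul_ite, mul_one,
    mul_zero]
  rw [Finset.sum_ite_eq']
  simp

theorem sigmaChar_one_ne_zero [Finite G] {X : Set (IrrChar G)} (hX : X.Nonempty) :
    sigmaChar X 1 ≠ 0 := by
  classical
  have := Fintype.ofFinite (IrrChar G)
  choose n hn hn' using IrrChar.exists_apply_one_eq (G := G)
  rw [sigmaChar_eq_sum, Finset.sum_apply]
  simp only [Pi.smul_apply, smul_eq_mul, hn']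
  obtain ⟨χ, hχ⟩ := hX
  have : 0 < ∑ χ : IrrChar G with χ ∈ X, n χ * n χ :=
    Finset.sum_pos (fun χ _ ↦ Nat.mul_pos (hn χ) (hn χ)) ⟨χ, by simpa using hχ⟩
  exact_mod_cast this.ne'

/-- If `σ_X` is constant on a subgroup `H`, then `H` acts trivially on every representation whose
character lies in `X`: the mean of `σ_X` over `H` is `∑ χ(1) d_χ`, where `d_χ ≤ χ(1)` is the
dimension of the space of `H`-invariants, and it equals `∑ χ(1) χ(1)`. -/
theorem apply_mul_of_subset_charKer_sigmaChar [Finite G] {X : Set (IrrChar G)} {H : Subgroup G}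
    (hH : (H : Set G) ⊆ charKer (sigmaChar X)) {χ : IrrChar G} (hχ : χ ∈ X) {h : G} (hh : h ∈ H)
    (x : G) : (χ : G → ℂ) (h * x) = (χ : G → ℂ) x := by
  classical
  have := Fintype.ofFinite (IrrChar G)
  have := Fintype.ofFinite H
  have hc : (Nat.card H : ℂ) ≠ 0 := by exact_mod_cast Nat.card_pos.ne'
  have : Invertible (Nat.card H : ℂ) := invertibleOfNonzero hc
  choose n ρ hρ hρ' using fun χ : IrrChar G ↦ χ.2
  let τ : ∀ χ : IrrChar G, Representation ℂ H (Fin (n χ) → ℂ) := fun χ ↦ (ρ χ).comp H.subtype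
  let d : IrrChar G → ℕ := fun χ ↦ Module.finrank ℂ (τ χ).invariants
  have hone : ∀ χ : IrrChar G, (χ : G → ℂ) 1 = n χ := fun χ ↦ by rw [hρ' χ]; simp
  have hd : ∀ χ : IrrChar G, (Nat.card H : ℂ)⁻¹ * ∑ h : H, (χ : G → ℂ) h = d χ := fun χ ↦ by
    rw [← Representation.card_inv_mul_sum_char_eq_finrank, hρ' χ]
    rfl
  have hle : ∀ χ, d χ ≤ n χ := fun χ ↦ by
    simpa using Submodule.finrank_le (τ χ).invariants
  have hmean : (Nat.card H : ℂ)⁻¹ * ∑ h : H, sigmaChar X h = sigmaChar X 1 := by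
    rw [Finset.sum_congr rfl fun h _ ↦ hH h.2]
    simp
  have hsum : ∑ χ : IrrChar G with χ ∈ X, n χ * d χ =
      ∑ χ : IrrChar G with χ ∈ X, n χ * n χ := by
    rw [sigmaChar_eq_sum] at hmean
    simp only [Finset.sum_apply, Pi.smul_apply, smul_eq_mul, hone] at hmean
    rw [Finset.sum_comm, Finset.mul_sum] at hmean
    simp only [← Finset.mul_sum, mul_left_comm _ (Nat.cast (n _) : ℂ), hd] at hmean
    exact_mod_cast hmean
  have heq : n χ * d χ = n χ * n χ :=
    (Finset.sum_eq_sum_iff_of_le fun χ _ ↦ Nat.mul_le_mul_left _ (hle χ)).1 hsum χ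
      (by simpa using hχ)
  have hn : n χ ≠ 0 := fun h0 ↦ IrrChar.apply_one_ne_zero χ (by simp [hone, h0])
  have hd' : d χ = Module.finrank ℂ (Fin (n χ) → ℂ) := by
    rw [Nat.eq_of_mul_eq_mul_left (Nat.pos_of_ne_zero hn) heq, Module.finrank_fin_fun]
  have htop : (τ χ).invariants = ⊤ := Submodule.eq_top_of_finrank_eq hd'
  have hid : ρ χ h = 1 := by
    refine LinearMap.ext fun v ↦ ?_
    have hv : v ∈ (τ χ).invariants := htop ▸ Submodule.mem_top
    exact hv ⟨h, hh⟩
  simp only [hρ' χ, Representation.character, map_mul, hid, one_mul]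

/-- If `σ_X` is constant on each of a family of subgroups, then it is constant on the subgroup
which they generate. -/
theorem sSup_subset_charKer_sigmaChar [Finite G] {X : Set (IrrChar G)} {F : Set (Subgroup G)}
    (hF : ∀ H ∈ F, (H : Set G) ⊆ charKer (sigmaChar X)) :
    ((sSup F : Subgroup G) : Set G) ⊆ charKer (sigmaChar X) := by
  -- The intersection of the kernels of the representations with character in `X`.
  let T : Subgroup G :=
    { carrier := {g | ∀ χ ∈ X, ∀ x, (χ : G → ℂ) (g * x) = (χ : G → ℂ) x}
      one_mem' := by simp
      mul_mem' := fun {a b} ha hb χ hχ x ↦ by rw [mul_assoc, ha χ hχ, hb χ hχ]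
      inv_mem' := fun {a} ha χ hχ x ↦ by rw [← ha χ hχ, mul_inv_cancel_left] }
  have hT : sSup F ≤ T := sSup_le fun H hH h hh χ hχ x ↦
    apply_mul_of_subset_charKer_sigmaChar (hF H hH) hχ hh x
  intro g hg
  exact finsum_mem_congr rfl fun χ hχ ↦ by
    have := hT hg χ hχ 1
    rw [mul_one] at this
    rw [this]

end sigmaChar

namespace SupercharacterTheory

variable {G : Type*} [Group G] (S : SupercharacterTheory G)

/-! ### Superclass functions -/

theorem mem_cl_self (g : G) : g ∈ S.cl g := by
  obtain ⟨K, ⟨hK, hg⟩, -⟩ := S.isPartition_classes.2 g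
  exact ⟨K, hK, hg, hg⟩

theorem cl_eq_of_mem {K : Set G} (hK : K ∈ S.classes) {g : G} (hg : g ∈ K) : S.cl g = K := by
  ext k
  refine ⟨?_, fun hk ↦ ⟨K, hK, hg, hk⟩⟩
  rintro ⟨L, hL, hgL, hk⟩
  rwa [Setoid.eq_of_mem_eqv_class S.isPartition_classes.2 hK hg hL hgL]

theorem cl_mem_classes (g : G) : S.cl g ∈ S.classes := by
  obtain ⟨K, ⟨hK, hg⟩, -⟩ := S.isPartition_classes.2 g
  rwa [S.cl_eq_of_mem hK hg]

theorem cl_eq_cl {g k : G} (h : k ∈ S.cl g) : S.cl k = S.cl g :=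
  S.cl_eq_of_mem (S.cl_mem_classes g) h

theorem cl_one : S.cl 1 = {1} := S.cl_eq_of_mem S.singleton_one_mem rfl

/-- The functions on `G` that are constant on every superclass. -/
def superclassFunctions : Submodule ℂ (G → ℂ) where
  carrier := {f | ∀ g, ∀ k ∈ S.cl g, f k = f g}
  add_mem' ha hb g k hk := by simp [ha g k hk, hb g k hk]
  zero_mem' := by simp
  smul_mem' c f hf g k hk := by simp [hf g k hk]

theorem sigmaChar_mem_superclassFunctions {X : Set (IrrChar G)} (hX : X ∈ S.parts) :
    sigmaChar X ∈ S.superclassFunctions := by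
  rintro g k ⟨K, hK, hg, hk⟩
  exact S.sigma_const X hX K hK k hk g hg

theorem parts_nonempty {X : Set (IrrChar G)} (hX : X ∈ S.parts) : X.Nonempty :=
  Setoid.nonempty_of_mem_partition S.isPartition_parts hX

theorem part_eq_of_mem {X Y : Set (IrrChar G)} (hX : X ∈ S.parts) (hY : Y ∈ S.parts)
    {χ : IrrChar G} (hχX : χ ∈ X) (hχY : χ ∈ Y) : X = Y :=
  Setoid.eq_of_mem_eqv_class S.isPartition_parts.2 hX hχX hY hχY

theorem linearIndependent_sigmaChar [Finite G] :
    LinearIndependent ℂ (fun X : S.parts ↦ sigmaChar X.1) := by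
  classical
  have := Fintype.ofFinite G
  rw [linearIndependent_iff']
  intro s a ha X hX
  obtain ⟨χ, hχ⟩ := S.parts_nonempty X.2
  have h := congrArg (IrrChar.coeff χ) ha
  simp only [map_sum, map_smul, coeff_sigmaChar, map_zero] at h
  rw [Finset.sum_eq_single X] at h
  · simpa [hχ, IrrChar.apply_one_ne_zero] using h
  · intro Y _ hYX
    rw [if_neg, smul_zero]
    exact fun hχY ↦ hYX (Subtype.ext (S.part_eq_of_mem Y.2 X.2 hχY hχ))
  · exact fun h ↦ absurd hX h

/-- The supercharacters form a basis of the space of superclass functions: they are linearly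
independent, and their number is that of the superclasses. -/
theorem span_irr [Finite G] : Submodule.span ℂ S.irr = S.superclassFunctions := by
  classical
  have := Fintype.ofFinite S.parts
  have := Fintype.ofFinite S.classes
  have hirr : S.irr = Set.range (fun X : S.parts ↦ sigmaChar X.1) := by
    ext f
    simp [irr, eq_comm]
  choose r hr using fun K : S.classes ↦ Setoid.nonempty_of_mem_partition S.isPartition_classes K.2
  have hle : Module.finrank ℂ S.superclassFunctions ≤ Fintype.card S.classes := by
    -- Restriction to a system of representatives of the superclasses.
    let L : S.superclassFunctions →ₗ[ℂ] (S.classes → ℂ) :=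
      (LinearMap.funLeft ℂ ℂ r).comp S.superclassFunctions.subtype
    have hL : Function.Injective L := by
      intro f₁ f₂ h
      ext g
      have hg := congrFun h ⟨S.cl g, S.cl_mem_classes g⟩
      have hrg := hr ⟨S.cl g, S.cl_mem_classes g⟩
      rw [← f₁.2 g _ hrg, ← f₂.2 g _ hrg]
      exact hg
    simpa using LinearMap.finrank_le_finrank_of_injective hL
  rw [hirr]
  refine Submodule.eq_of_le_of_finrank_le ?_ ?_
  · rw [Submodule.span_le]
    rintro _ ⟨X, rfl⟩
    exact S.sigmaChar_mem_superclassFunctions X.2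
  · rw [finrank_span_eq_card S.linearIndependent_sigmaChar]
    refine hle.trans (le_of_eq ?_)
    rw [← Nat.card_eq_fintype_card, ← Nat.card_eq_fintype_card]
    exact S.card_eq.symm

theorem superclassFunctions_induction [Finite G] {p : (G → ℂ) → Prop}
    (sigma : ∀ X ∈ S.parts, p (sigmaChar X)) (zero : p 0)
    (add : ∀ f₁ f₂, p f₁ → p f₂ → p (f₁ + f₂)) (smul : ∀ (a : ℂ) f, p f → p (a • f))
    {f : G → ℂ} (hf : f ∈ S.superclassFunctions) : p f := by
  rw [← S.span_irr] at hf
  refine Submodule.span_induction (p := fun f _ ↦ p f) ?_ zero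
    (fun f₁ f₂ _ _ ↦ add f₁ f₂) (fun a f _ ↦ smul a f) hf
  rintro _ ⟨X, hX, rfl⟩
  exact sigma X hX

/-- The coefficients of a superclass function at the characters of one part are proportional to
the degrees. -/
theorem coeff_mul_apply_one [Fintype G] {f : G → ℂ} (hf : f ∈ S.superclassFunctions)
    {X : Set (IrrChar G)} (hX : X ∈ S.parts) {χ ψ : IrrChar G} (hχ : χ ∈ X) (hψ : ψ ∈ X) :
    IrrChar.coeff χ f * (ψ : G → ℂ) 1 = IrrChar.coeff ψ f * (χ : G → ℂ) 1 := by
  classical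
  refine S.superclassFunctions_induction
    (p := fun f ↦ IrrChar.coeff χ f * (ψ : G → ℂ) 1 = IrrChar.coeff ψ f * (χ : G → ℂ) 1)
    (fun Y hY ↦ ?_) (by simp) (fun f₁ f₂ h₁ h₂ ↦ ?_) (fun a f h ↦ ?_) hf
  · have : χ ∈ Y ↔ ψ ∈ Y :=
      ⟨fun h ↦ S.part_eq_of_mem hX hY hχ h ▸ hψ, fun h ↦ S.part_eq_of_mem hX hY hψ h ▸ hχ⟩
    rw [coeff_sigmaChar, coeff_sigmaChar, if_congr this rfl rfl]
    split_ifs <;> ring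
  · simp only [map_add, add_mul, h₁, h₂]
  · simp only [map_smul, smul_eq_mul, mul_assoc, h]

/-- A superclass is a union of conjugacy classes: its indicator is a combination of characters. -/
theorem conj_mem_cl [Finite G] (g x : G) : x * g * x⁻¹ ∈ S.cl g := by
  classical
  have hf : (S.cl g).indicator 1 ∈ S.superclassFunctions := by
    intro h k hk
    have : k ∈ S.cl g ↔ h ∈ S.cl g := by
      constructor
      · intro hkg
        rw [← S.cl_eq_cl hkg, S.cl_eq_cl hk]
        exact S.mem_cl_self h
      · intro hhg
        rwa [← S.cl_eq_cl hhg]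
    simp [Set.indicator_apply, this]
  have key := S.superclassFunctions_induction (p := fun f ↦ f (x * g * x⁻¹) = f g)
    (fun X _ ↦ finsum_mem_congr rfl fun χ _ ↦ by rw [IrrChar.apply_conj]) rfl
    (fun f₁ f₂ h₁ h₂ ↦ by simp only [Pi.add_apply, h₁, h₂])
    (fun a f h ↦ by simp only [Pi.smul_apply, h]) hf
  by_contra hx
  rw [Set.indicator_of_notMem hx, Set.indicator_of_mem (S.mem_cl_self g)] at key
  simp at key

/-! ### The center -/

theorem mem_center_iff {z : G} : z ∈ S.center ↔ S.cl z = {z} := by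
  refine ⟨fun hz ↦ ?_, fun hz ↦ by simp [center, hz]⟩
  obtain ⟨a, ha⟩ := Set.ncard_eq_one.1 hz
  have : z ∈ ({a} : Set G) := ha ▸ S.mem_cl_self z
  rw [ha, Set.mem_singleton_iff.1 this]

theorem single_mem_superclassFunctions [DecidableEq G] {z : G} :
    Pi.single z 1 ∈ S.superclassFunctions ↔ z ∈ S.center := by
  rw [mem_center_iff]
  refine ⟨fun h ↦ ?_, fun hz g k hk ↦ ?_⟩
  · refine Set.eq_singleton_iff_unique_mem.2 ⟨S.mem_cl_self z, fun k hk ↦ ?_⟩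
    by_contra hkz
    simpa [hkz] using h z k hk
  · have : k = z ↔ g = z := by
      constructor
      · rintro rfl
        have : g ∈ S.cl k := S.cl_eq_cl hk ▸ S.mem_cl_self g
        rwa [hz] at this
      · rintro rfl
        rwa [hz] at hk
    simp [Pi.single_apply, this]

theorem central_of_mem_center [Finite G] {z : G} (hz : z ∈ S.center) (x : G) :
    z * x = x * z := by
  have h := S.conj_mem_cl z x
  rw [S.mem_center_iff.1 hz, Set.mem_singleton_iff, mul_inv_eq_iff_eq_mul] at h
  exact h.symm

/-- Translation by a central element multiplies a supercharacter by a scalar. By Schur's lemma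
this holds for irreducible characters; as the indicator of `z` is a superclass function, the
scalar is the same for all members of one part. -/
theorem sigmaChar_inv_mul_of_mem_center [Finite G] {z : G} (hz : z ∈ S.center)
    {X : Set (IrrChar G)} (hX : X ∈ S.parts) :
    ∃ c : ℂ, c ≠ 0 ∧ ∀ x, sigmaChar X (z⁻¹ * x) = c * sigmaChar X x := by
  classical
  have := Fintype.ofFinite G
  have := Fintype.ofFinite (IrrChar G)
  have hcard : (Nat.card G : ℂ) ≠ 0 := by exact_mod_cast Nat.card_pos.ne'
  have hcomm : ∀ x, z⁻¹ * x = x * z⁻¹ := fun x ↦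
    (Commute.inv_left (S.central_of_mem_center hz x) : Commute z⁻¹ x)
  choose c hc0 hc using fun χ : IrrChar G ↦ IrrChar.apply_mul_of_central χ hcomm
  have hcoeff : ∀ χ : IrrChar G, IrrChar.coeff χ (Pi.single z 1) =
      (Nat.card G : ℂ)⁻¹ * (c χ * (χ : G → ℂ) 1) := fun χ ↦ by
    rw [IrrChar.coeff_apply, ← hc, mul_one]
    simp [Pi.single_apply]
  obtain ⟨χ₀, hχ₀⟩ := S.parts_nonempty hX
  refine ⟨c χ₀, hc0 χ₀, fun x ↦ ?_⟩
  simp only [sigmaChar_eq_sum, Finset.sum_apply, Pi.smul_apply, smul_eq_mul, Finset.mul_sum]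
  refine Finset.sum_congr rfl fun χ hχ ↦ ?_
  have h := S.coeff_mul_apply_one (S.single_mem_superclassFunctions.2 hz) hX
    (Finset.mem_filter.1 hχ).2 hχ₀
  rw [hcoeff, hcoeff] at h
  have hcc : c χ = c χ₀ := by
    have h1 := IrrChar.apply_one_ne_zero χ
    have h2 := IrrChar.apply_one_ne_zero χ₀
    field_simp at h
    exact h
  rw [hc, hcc]
  ring

theorem sigmaChar_ne_zero_of_mem_center [Finite G] {z : G} (hz : z ∈ S.center)
    {X : Set (IrrChar G)} (hX : X ∈ S.parts) : sigmaChar X z ≠ 0 := by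
  obtain ⟨c, hc, h⟩ := S.sigmaChar_inv_mul_of_mem_center hz hX
  intro h0
  apply sigmaChar_one_ne_zero (S.parts_nonempty hX)
  rw [← inv_mul_cancel z, h, h0, mul_zero]

/-- The superclass functions are stable under translation by a central element. -/
theorem comp_inv_mul_mem_superclassFunctions [Finite G] {z : G} (hz : z ∈ S.center)
    {f : G → ℂ} (hf : f ∈ S.superclassFunctions) :
    (fun x ↦ f (z⁻¹ * x)) ∈ S.superclassFunctions := by
  refine S.superclassFunctions_induction
    (p := fun f ↦ (fun x ↦ f (z⁻¹ * x)) ∈ S.superclassFunctions) (fun X hX ↦ ?_)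
    (zero_mem S.superclassFunctions) (fun f₁ f₂ h₁ h₂ ↦ add_mem h₁ h₂)
    (fun a f h ↦ Submodule.smul_mem _ a h) hf
  obtain ⟨c, -, h⟩ := S.sigmaChar_inv_mul_of_mem_center hz hX
  rw [funext h]
  exact Submodule.smul_mem _ c (S.sigmaChar_mem_superclassFunctions hX)

/-- The center of a supercharacter theory, as a subgroup. -/
def centerSubgroup [Finite G] : Subgroup G :=
  let M : Submonoid G :=
    { carrier := S.center
      one_mem' := S.mem_center_iff.2 S.cl_one
      mul_mem' := fun {z w} hz hw ↦ by
        classical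
        rw [← single_mem_superclassFunctions] at hw ⊢
        convert S.comp_inv_mul_mem_superclassFunctions hz hw using 2 with x
        simp [Pi.single_apply, inv_mul_eq_iff_eq_mul] }
  { M with
    inv_mem' := fun {z} hz ↦ by
      have h : z⁻¹ = z ^ (Nat.card G - 1) := by
        refine inv_eq_of_mul_eq_one_left ?_
        rw [← pow_succ, Nat.sub_add_cancel Nat.card_pos, pow_card_eq_one']
      rw [h]
      exact M.pow_mem hz _ }

theorem coe_centerSubgroup [Finite G] : (S.centerSubgroup : Set G) = S.center := rfl

/-! ### The commutator subgroup -/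

theorem inv_mul_mem_commutator {g k : G} (hk : k ∈ S.cl g) : g⁻¹ * k ∈ S.commutator ⊤ :=
  Subgroup.subset_closure ⟨g, Subgroup.mem_top g, k, hk, rfl⟩

theorem isNormal_commutator : S.IsNormal (S.commutator ⊤) := by
  refine ⟨{K | K ∈ S.classes ∧ K ⊆ S.commutator ⊤}, fun K hK ↦ hK.1, ?_⟩
  refine Set.Subset.antisymm (fun g hg ↦ ⟨S.cl g, ⟨S.cl_mem_classes g, fun k hk ↦ ?_⟩,
    S.mem_cl_self g⟩) (Set.sUnion_subset fun K hK ↦ hK.2)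
  rw [← mul_inv_cancel_left g k]
  exact mul_mem hg (S.inv_mul_mem_commutator hk)

theorem isAbelian_of_commutator_eq_bot (h : S.commutator ⊤ = ⊥) : S.IsAbelian := by
  refine Set.eq_univ_of_forall fun g ↦ S.mem_center_iff.2 ?_
  refine Set.eq_singleton_iff_unique_mem.2 ⟨S.mem_cl_self g, fun k hk ↦ ?_⟩
  have := S.inv_mul_mem_commutator hk
  rw [h, Subgroup.mem_bot, inv_mul_eq_one] at this
  exact this.symm

theorem commutator_le [Finite G] : _root_.commutator G ≤ S.commutator ⊤ := by
  rw [commutator_def, Subgroup.commutator_le]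
  intro x _ y _
  have h := S.inv_mul_mem_commutator (S.conj_mem_cl x⁻¹ y)
  rwa [inv_inv, ← mul_assoc, ← mul_assoc] at h

/-- The supercharacters separate `1` from the other elements. -/
theorem exists_irrOver [Finite G] {N : Subgroup G} (hN : N ≠ ⊥) : (S.irrOver N).Nonempty := by
  classical
  obtain ⟨g, hg, hg1⟩ := N.bot_or_exists_ne_one.resolve_left hN
  by_contra hempty
  have hker : ∀ X ∈ S.parts, sigmaChar X g = sigmaChar X 1 := fun X hX ↦ by
    by_contra hne
    exact hempty ⟨sigmaChar X, ⟨X, hX, rfl⟩, fun hle ↦ hne (hle hg)⟩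
  have h := S.superclassFunctions_induction (p := fun f ↦ f g = f 1) hker rfl
    (fun f₁ f₂ h₁ h₂ ↦ by simp only [Pi.add_apply, h₁, h₂])
    (fun a f h ↦ by simp only [Pi.smul_apply, h])
    (S.single_mem_superclassFunctions.2 (S.mem_center_iff.2 S.cl_one))
  simp [hg1] at h

/-- A linear character which is a superclass function is a supercharacter: by orthogonality no
other character can lie in its part. -/
theorem monoidHom_mem_irr [Finite G] (φ : G →* ℂˣ)
    (hφ : (fun g ↦ (φ g : ℂ)) ∈ S.superclassFunctions) : (fun g ↦ (φ g : ℂ)) ∈ S.irr := by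
  classical
  have := Fintype.ofFinite G
  have := Fintype.ofFinite (IrrChar G)
  let χ : IrrChar G := ⟨_, IrrChar.monoidHom_mem φ⟩
  obtain ⟨X, ⟨hX, hχ⟩, -⟩ := S.isPartition_parts.2 χ
  have hXχ : ∀ ψ ∈ X, ψ = χ := fun ψ hψ ↦ by
    have h := S.coeff_mul_apply_one hφ hX hχ hψ
    have h1 : IrrChar.coeff χ (χ : G → ℂ) = 1 := by
      rw [IrrChar.coeff_apply, IrrChar.orthonormal, if_pos rfl]
    by_contra hne
    have h2 : IrrChar.coeff ψ (χ : G → ℂ) = 0 := by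
      rw [IrrChar.coeff_apply, IrrChar.orthonormal, if_neg (Ne.symm hne)]
    change IrrChar.coeff χ (χ : G → ℂ) * _ = IrrChar.coeff ψ (χ : G → ℂ) * _ at h
    rw [h1, h2, one_mul, zero_mul] at h
    exact IrrChar.apply_one_ne_zero ψ h
  refine ⟨X, hX, ?_⟩
  have hXs : X = {χ} := Set.eq_singleton_iff_unique_mem.2 ⟨hχ, hXχ⟩
  ext g
  rw [hXs, sigmaChar, finsum_mem_singleton]
  simp [χ]

/-- An element outside `[G, S]` is not in the kernel of some nowhere vanishing supercharacter,
namely a linear character of the abelian group `G / [G, S]`. -/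
theorem exists_irr_of_notMem_commutator [Finite G] {h : G} (hh : h ∉ S.commutator ⊤) :
    ∃ χ ∈ S.irr, χ h ≠ χ 1 ∧ ∀ g, χ g ≠ 0 := by
  have hnormal : (S.commutator ⊤).Normal := Subgroup.Normal.of_commutator_le _ S.commutator_le
  let _ : CommGroup (G ⧸ S.commutator ⊤) :=
    { (inferInstance : Group (G ⧸ S.commutator ⊤)) with
      mul_comm := (Subgroup.Normal.quotient_commutative_iff_commutator_le.2
        S.commutator_le).is_comm.comm }
  obtain ⟨φ, hφ⟩ := CommGroup.exists_apply_ne_one_of_hasEnoughRootsOfUnity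
    (G ⧸ S.commutator ⊤) ℂ (a := (h : G ⧸ S.commutator ⊤))
    (fun h1 ↦ hh ((QuotientGroup.eq_one_iff h).1 h1))
  refine ⟨_, S.monoidHom_mem_irr (φ.comp (QuotientGroup.mk' _)) fun g k hk ↦ ?_, ?_, ?_⟩
  · have : (k : G ⧸ S.commutator ⊤) = g :=
      (QuotientGroup.eq.2 (S.inv_mul_mem_commutator hk)).symm
    simp [this]
  · simpa using hφ
  · simp

/-! ### Vanishing-off subgroups -/

theorem vanishingOff_subset_center_iff [Finite G] {N : Subgroup G} :
    (S.vanishingOff N : Set G) ⊆ S.center ↔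
      ∀ χ ∈ S.irrOver N, ∀ g : G, g ∉ S.center → χ g = 0 := by
  constructor
  · intro h χ hχ g hg
    by_contra hne
    exact hg (h (Subgroup.subset_closure ⟨χ, hχ, hne⟩))
  · intro h
    rw [← S.coe_centerSubgroup, SetLike.coe_subset_coe, vanishingOff, Subgroup.closure_le]
    rintro g ⟨χ, hχ, hne⟩
    by_contra hg
    exact hne (h χ hχ g hg)

theorem center_subset_vanishingOff [Finite G] {N : Subgroup G} (hN : N ≠ ⊥) :
    S.center ⊆ S.vanishingOff N := by
  intro z hz
  obtain ⟨χ, hχ⟩ := S.exists_irrOver hN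
  obtain ⟨X, hX, rfl⟩ := hχ.1
  exact Subgroup.subset_closure ⟨_, hχ, S.sigmaChar_ne_zero_of_mem_center hz hX⟩

/-- If `H` were not contained in `[G, S]`, then `Irr(S | H)` would contain a nowhere vanishing
linear character, and `V(S | H)` would be `G`. -/
theorem le_commutator_of_vanishingOff_subset_center [Finite G] (hS : ¬ S.IsAbelian)
    {H : Subgroup G} (hH : (S.vanishingOff H : Set G) ⊆ S.center) : H ≤ S.commutator ⊤ := by
  intro h hh
  by_contra hcomm
  obtain ⟨χ, hχ, hne, hnz⟩ := S.exists_irr_of_notMem_commutator hcomm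
  refine hS (Set.eq_univ_of_forall fun g ↦ hH (Subgroup.subset_closure ⟨χ, ⟨hχ, ?_⟩, hnz g⟩))
  exact fun hker ↦ hne (hker hh)

/-- If `U(S)` is not in the kernel of a supercharacter, then some member `H` of the family that
generates `U(S)` is not, and the supercharacter vanishes off `V(S | H)`. -/
theorem vanishingOff_U_subset_center [Finite G] : (S.vanishingOff S.U : Set G) ⊆ S.center := by
  rw [vanishingOff_subset_center_iff]
  rintro _ ⟨⟨X, hX, rfl⟩, hker⟩
  have hex : ∃ H, (S.IsNormal H ∧ (S.vanishingOff H : Set G) ⊆ S.center) ∧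
      ¬ (H : Set G) ⊆ charKer (sigmaChar X) := by
    by_contra! hall
    exact hker (sSup_subset_charKer_sigmaChar hall)
  obtain ⟨H, ⟨-, hH⟩, hHker⟩ := hex
  exact S.vanishingOff_subset_center_iff.1 hH _ ⟨⟨X, hX, rfl⟩, hHker⟩

end SupercharacterTheory

theorem mainTheorem4 {G : Type*} [Group G] [Finite G] (S : SupercharacterTheory G)
    (hS : ¬ S.IsAbelian) :
    List.TFAE [S.IsVZ, S.center = (S.V : Set G), S.U = S.commutator ⊤] := by
  have hVZ : S.IsVZ ↔ (S.V : Set G) ⊆ S.center := S.vanishingOff_subset_center_iff.symm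
  have hne : S.commutator ⊤ ≠ ⊥ := fun h ↦ hS (S.isAbelian_of_commutator_eq_bot h)
  tfae_have 1 → 2 := fun h ↦
    Set.Subset.antisymm (S.center_subset_vanishingOff hne) (hVZ.1 h)
  tfae_have 2 → 1 := fun h ↦ hVZ.2 h.ge
  tfae_have 1 → 3 := fun h ↦ le_antisymm
    (sSup_le fun H hH ↦ S.le_commutator_of_vanishingOff_subset_center hS hH.2)
    (le_sSup ⟨S.isNormal_commutator, hVZ.1 h⟩)
  tfae_have 3 → 1 := fun h ↦ hVZ.2 (by
    rw [SupercharacterTheory.V, ← h]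
    exact S.vanishingOff_U_subset_center)
  tfae_finish
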